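/- Let $F$ be a field and $G$ a finite group such that $\operatorname{char} F$ does not divide $|G|$. For a finite group $K$ and a finite dimensional $FK$-module $W$, let $S(W)$ be the symmetric algebra of $W$, with the action of $K$ by $F$-algebra automorphisms that extends the linear action on $W$, and let $S(W)^K$ be the subalgebra of $K$-invariants. Let $\beta(K,W)$ be the smallest non-negative integer $d$ such that $S(W)^K$ is generated as an $F$-algebra by its elements of degree at most $d$ (with $\beta(K,W)=\infty$ if there is no such $d$), and let $\beta(K)=\sup_W \beta(K,W)\in\mathbb{N}\cup\{\infty\}$, the supremum being taken over all finite dimensional $FK$-modules $W$; this is the Noether number of $K$ over $F$. Then: (1) $\beta(G)>\beta(H)$ for every proper subgroup $H\subsetneq G$ (in particular $\beta(H)$ is finite); (2) $\beta(G)\ge\beta(N)+\beta(G/N)-1$ for every normal subgroup $N$ of $G$. -/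

import Mathlib

namespace NoetherNumber

universe u v w

section Module

variable {F : Type u} {G : Type v} {W : Type w} [Field F] [Group G] [AddCommGroup W] [Module F W]

/-- The homogeneous component `S(W)_d` of the symmetric algebra of `W`: the `F`-span of all
products of `d` elements of `W` (for `d = 0` this is the line `F ⊆ S(W)`). -/
def homogeneousPart (F : Type u) (W : Type w) [Field F] [AddCommGroup W] [Module F W] (d : ℕ) :
    Submodule F (SymmetricAlgebra F W) :=
  LinearMap.range (SymmetricAlgebra.ι F W) ^ d

/-- The elements of `S(W)` of degree at most `d`: the sum of the homogeneous components `S(W)_i`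
with `i ≤ d`. -/
def degreeLE (F : Type u) (W : Type w) [Field F] [AddCommGroup W] [Module F W] (d : ℕ) :
    Submodule F (SymmetricAlgebra F W) :=
  ⨆ i ∈ Finset.range (d + 1), homogeneousPart F W i

/-- The `F`-algebra endomorphism of `S(W)` extending the linear action of `g` on `W`. -/
noncomputable def act (ρ : Representation F G W) (g : G) :
    SymmetricAlgebra F W →ₐ[F] SymmetricAlgebra F W :=
  SymmetricAlgebra.lift (SymmetricAlgebra.ι F W ∘ₗ ρ g)

/-- The subalgebra `S(W)^G` of `G`-invariants. -/
noncomputable def invariants (ρ : Representation F G W) : Subalgebra F (SymmetricAlgebra F W) :=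
  ⨅ g : G, AlgHom.equalizer (act ρ g) (AlgHom.id F (SymmetricAlgebra F W))

theorem mem_invariants (ρ : Representation F G W) (f : SymmetricAlgebra F W) :
    f ∈ invariants ρ ↔ ∀ g : G, act ρ g f = f := by
  simp [invariants, Algebra.mem_iInf, AlgHom.mem_equalizer]

/-- `S(W)^G` is generated as an `F`-algebra by its elements of degree at most `d`. -/
def GeneratedInDegreeLE (ρ : Representation F G W) (d : ℕ) : Prop :=
  Algebra.adjoin F {f : SymmetricAlgebra F W | f ∈ invariants ρ ∧ f ∈ degreeLE F W d} =
    invariants ρ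

/-- The Noether number `β(G, W)` of a representation: the smallest `d` such that `S(W)^G` is
generated as an algebra by its elements of degree at most `d` (`⊤` if there were no such `d`). -/
noncomputable def betaRep (ρ : Representation F G W) : ℕ∞ :=
  ⨅ (d : ℕ) (_ : GeneratedInDegreeLE ρ d), (d : ℕ∞)

end Module

/-- The Noether number `β(G)` of the group `G` over the field `F`: the supremum of `β(G, W)` over
all finite dimensional `F G`-modules `W`. (Each of them is isomorphic to one whose underlying type
lives in the universe of `F`.) -/
noncomputable def beta (F : Type u) (G : Type v) [Field F] [Group G] : ℕ∞ :=
  ⨆ (W : Type u) (_ : AddCommGroup W) (_ : Module F W) (_ : Module.Finite F W)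
    (ρ : Representation F G W), betaRep ρ

end NoetherNumber

/-! Since |G| is invertible in F, the Reynolds operator R is available. By graded Nakayama, β(G, W)
> d means that some homogeneous invariant of degree > d is indecomposable, i.e. outside the square
of the space of invariants without constant term.

Everything rests on one lower bound, `succ_le_beta`: if K ≤ G, V is a G-module, and s ∈ S(V)^K is
homogeneous of degree d but outside S(V)^G_+ · S(V)^K, then β(G) ≥ d + 1. To see it, adjoin the
permutation module on G/K and let x be the indicator of the coset K. If the invariant R(s x), of
degree d + 1, were decomposable, its coefficient at x, a nonzero multiple of s, would lie in
S(V)^G_+ · S(V)^K.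

For (1), take an indecomposable invariant f of H on W in degree at least β(H), and view it in S(V)
for V coinduced from W. Comparing evaluations at 1 and at some x ∉ H shows that f meets the
hypothesis with K = H, so β(G) ≥ β(H) + 1. Noether's bound β(H) ≤ |H| supplies finiteness.

For (2), take K = 1. In degrees β(N) - 1 and β(G/N) - 1 there are s ∈ S(W) and t ∈ S(U) outside the
respective Hilbert ideals. On the sum of U and the coinduced module of W, evaluation at 1 sends the
positive G-invariants to zero in the tensor product of the two coinvariant algebras, while st goes
to a nonzero pure tensor. So β(G) ≥ (β(N) - 1) + (β(G/N) - 1) + 1. -/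

namespace NoetherNumber

universe u v w

/-! ### The grading of the symmetric algebra and its functoriality. -/

section Grading

variable {F : Type*} [Field F] {W : Type*} [AddCommGroup W] [Module F W]
  {W' : Type*} [AddCommGroup W'] [Module F W'] {W'' : Type*} [AddCommGroup W''] [Module F W'']

open Polynomial in
/-- The algebra homomorphism `S(W) → S(W)[t]` sending `w ∈ W` to `w t`; it sends a homogeneous
element `f` of degree `d` to `f t ^ d`. -/
noncomputable def grading (F W : Type*) [Field F] [AddCommGroup W] [Module F W] :
    SymmetricAlgebra F W →ₐ[F] (SymmetricAlgebra F W)[X] :=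
  SymmetricAlgebra.lift (((monomial 1).restrictScalars F) ∘ₗ SymmetricAlgebra.ι F W)

/-- The projection of `S(W)` onto its homogeneous component of degree `d`. -/
noncomputable def component (F W : Type*) [Field F] [AddCommGroup W] [Module F W] (d : ℕ) :
    SymmetricAlgebra F W →ₗ[F] SymmetricAlgebra F W :=
  ((Polynomial.lcoeff (SymmetricAlgebra F W) d).restrictScalars F) ∘ₗ (grading F W).toLinearMap

/-- The algebra homomorphism `S(W) → S(W')` induced by a linear map `W → W'`. -/
noncomputable def symMap (φ : W →ₗ[F] W') : SymmetricAlgebra F W →ₐ[F] SymmetricAlgebra F W' :=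
  SymmetricAlgebra.lift (SymmetricAlgebra.ι F W' ∘ₗ φ)

/-- The augmentation `S(W) → F`, which takes the constant term. -/
noncomputable def aug (F W : Type*) [Field F] [AddCommGroup W] [Module F W] :
    SymmetricAlgebra F W →ₐ[F] F :=
  SymmetricAlgebra.lift 0

@[simp]
theorem grading_ι (w : W) :
    grading F W (SymmetricAlgebra.ι F W w) = Polynomial.monomial 1 (SymmetricAlgebra.ι F W w) := by
  simp [grading]

@[simp]
theorem symMap_ι (φ : W →ₗ[F] W') (w : W) :
    symMap φ (SymmetricAlgebra.ι F W w) = SymmetricAlgebra.ι F W' (φ w) := by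
  simp [symMap]

@[simp]
theorem aug_ι (w : W) : aug F W (SymmetricAlgebra.ι F W w) = 0 := by
  simp [aug]

theorem component_apply (d : ℕ) (f : SymmetricAlgebra F W) :
    component F W d f = (grading F W f).coeff d := rfl

theorem symMap_comp (ψ : W' →ₗ[F] W'') (φ : W →ₗ[F] W') (f : SymmetricAlgebra F W) :
    symMap ψ (symMap φ f) = symMap (ψ ∘ₗ φ) f := by
  have : (symMap ψ).comp (symMap φ) = symMap (ψ ∘ₗ φ) := by
    ext w; simp
  exact congr($this f)

theorem symMap_id (f : SymmetricAlgebra F W) : symMap (LinearMap.id : W →ₗ[F] W) f = f := by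
  have : symMap (LinearMap.id : W →ₗ[F] W) = AlgHom.id F _ := by
    ext w; simp
  exact congr($this f)

theorem symMap_zero (f : SymmetricAlgebra F W) :
    symMap (0 : W →ₗ[F] W') f = algebraMap F _ (aug F W f) := by
  have : symMap (0 : W →ₗ[F] W') = (Algebra.ofId F _).comp (aug F W) := by
    ext w; simp
  exact congr($this f)

theorem aug_symMap (φ : W →ₗ[F] W') (f : SymmetricAlgebra F W) :
    aug F W' (symMap φ f) = aug F W f := by
  have : (aug F W').comp (symMap φ) = aug F W := by
    ext w; simp
  exact congr($this f)

theorem component_symMap (φ : W →ₗ[F] W') (d : ℕ) (f : SymmetricAlgebra F W) :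
    component F W' d (symMap φ f) = symMap φ (component F W d f) := by
  have : (grading F W').comp (symMap φ) =
      (Polynomial.mapAlgHom (symMap φ)).comp (grading F W) := by
    ext w : 2; simp
  have h : grading F W' (symMap φ f) = Polynomial.mapAlgHom (symMap φ) (grading F W f) :=
    congr($this f)
  simp [component_apply, h]

theorem ι_mem_homogeneousPart (w : W) :
    SymmetricAlgebra.ι F W w ∈ homogeneousPart F W 1 := by
  simp [homogeneousPart]

theorem mul_mem_homogeneousPart {d e : ℕ} {f g : SymmetricAlgebra F W}
    (hf : f ∈ homogeneousPart F W d) (hg : g ∈ homogeneousPart F W e) :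
    f * g ∈ homogeneousPart F W (d + e) := by
  rw [homogeneousPart, pow_add]
  exact Submodule.mul_mem_mul hf hg

theorem algebraMap_mem_homogeneousPart (r : F) :
    algebraMap F (SymmetricAlgebra F W) r ∈ homogeneousPart F W 0 := by
  rw [homogeneousPart, pow_zero]
  exact Submodule.mem_one.2 ⟨r, rfl⟩

theorem symMap_mem_homogeneousPart (φ : W →ₗ[F] W') {d : ℕ} {f : SymmetricAlgebra F W}
    (hf : f ∈ homogeneousPart F W d) : symMap φ f ∈ homogeneousPart F W' d := by
  have h : (homogeneousPart F W d).map (symMap φ).toLinearMap ≤ homogeneousPart F W' d := by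
    rw [homogeneousPart, Submodule.map_pow]
    refine pow_le_pow_left' ?_ d
    rintro _ ⟨_, ⟨w, rfl⟩, rfl⟩
    exact ⟨φ w, by simp⟩
  exact h ⟨f, hf, rfl⟩

theorem grading_of_mem {d : ℕ} {f : SymmetricAlgebra F W} (hf : f ∈ homogeneousPart F W d) :
    grading F W f = Polynomial.monomial d f := by
  induction d generalizing f with
  | zero =>
    rw [homogeneousPart, pow_zero] at hf
    obtain ⟨r, rfl⟩ := Submodule.mem_one.1 hf
    simp [Polynomial.algebraMap_apply]
  | succ d ih =>
    rw [homogeneousPart, pow_succ] at hf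
    induction hf using Submodule.mul_induction_on' with
    | mem_mul_mem a ha b hb =>
      obtain ⟨w, rfl⟩ := hb
      rw [map_mul, ih ha, grading_ι, Polynomial.monomial_mul_monomial]
    | add a _ b _ ha hb => rw [map_add, map_add, ha, hb]

theorem component_of_mem {d : ℕ} {f : SymmetricAlgebra F W} (hf : f ∈ homogeneousPart F W d) :
    component F W d f = f := by
  simp [component_apply, grading_of_mem hf]

theorem component_of_mem_of_ne {d e : ℕ} (h : d ≠ e) {f : SymmetricAlgebra F W}
    (hf : f ∈ homogeneousPart F W d) : component F W e f = 0 := by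
  simp [component_apply, grading_of_mem hf, Polynomial.coeff_monomial, h]

theorem component_mul (d : ℕ) (f g : SymmetricAlgebra F W) :
    component F W d (f * g) =
      ∑ p ∈ Finset.HasAntidiagonal.antidiagonal d, component F W p.1 f * component F W p.2 g := by
  simp [component_apply, Polynomial.coeff_mul]

theorem component_mem (d : ℕ) (f : SymmetricAlgebra F W) :
    component F W d f ∈ homogeneousPart F W d := by
  induction f using SymmetricAlgebra.induction generalizing d with
  | algebraMap r =>
    by_cases h : 0 = d
    · subst h
      rw [component_of_mem (algebraMap_mem_homogeneousPart r)]
      exact algebraMap_mem_homogeneousPart r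
    · rw [component_of_mem_of_ne h (algebraMap_mem_homogeneousPart r)]
      exact zero_mem _
  | ι w =>
    by_cases h : 1 = d
    · subst h
      rw [component_of_mem (ι_mem_homogeneousPart w)]
      exact ι_mem_homogeneousPart w
    · rw [component_of_mem_of_ne h (ι_mem_homogeneousPart w)]
      exact zero_mem _
  | mul a b ha hb =>
    rw [component_mul]
    refine sum_mem fun p hp => ?_
    rw [← Finset.HasAntidiagonal.mem_antidiagonal.1 hp]
    exact mul_mem_homogeneousPart (ha _) (hb _)
  | add a b ha hb => rw [map_add]; exact add_mem (ha d) (hb d)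

theorem sum_component (f : SymmetricAlgebra F W) :
    ∑ d ∈ (grading F W f).support, component F W d f = f := by
  have : ((Polynomial.aeval (1 : SymmetricAlgebra F W)).restrictScalars F).comp (grading F W) =
      AlgHom.id F _ := by
    ext w; simp
  have h : Polynomial.aeval (1 : SymmetricAlgebra F W) (grading F W f) = f := congr($this f)
  conv_rhs => rw [← h, Polynomial.aeval_eq_sum_range' (Nat.lt_succ_self _)]
  simp only [one_pow, smul_eq_mul, mul_one, component_apply]
  refine Finset.sum_subset (fun d hd => ?_) (fun d _ hd => by simpa using hd)
  exact Finset.mem_range.2 (Nat.lt_succ_of_le (Polynomial.le_natDegree_of_mem_supp d hd))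

theorem component_zero (f : SymmetricAlgebra F W) :
    component F W 0 f = algebraMap F _ (aug F W f) := by
  induction f using SymmetricAlgebra.induction with
  | algebraMap r => simp [component_of_mem (algebraMap_mem_homogeneousPart r)]
  | ι w => simp [component_of_mem_of_ne one_ne_zero (ι_mem_homogeneousPart w)]
  | mul a b ha hb => simp [component_mul, ha, hb]
  | add a b ha hb => simp [ha, hb]

theorem aug_of_mem {d : ℕ} (hd : d ≠ 0) {f : SymmetricAlgebra F W}
    (hf : f ∈ homogeneousPart F W d) : aug F W f = 0 := by
  have h := component_zero f
  rw [component_of_mem_of_ne hd hf] at h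
  exact (SymmetricAlgebra.algebraMap_eq_zero_iff W _).1 h.symm

theorem component_eq_zero_of_mem_degreeLE {d e : ℕ} (h : d < e) {f : SymmetricAlgebra F W}
    (hf : f ∈ degreeLE F W d) : component F W e f = 0 := by
  have : degreeLE F W d ≤ LinearMap.ker (component F W e) := by
    refine iSup₂_le fun i hi g hg => ?_
    exact component_of_mem_of_ne (by have := Finset.mem_range.1 hi; omega) hg
  exact this hf

theorem homogeneousPart_le_degreeLE {d e : ℕ} (h : e ≤ d) :
    homogeneousPart F W e ≤ degreeLE F W d :=
  le_iSup₂_of_le e (Finset.mem_range.2 (by omega)) le_rfl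

end Grading

/-! ### Indecomposable invariants and the Noether number. -/

section Invariants

variable {F : Type*} [Field F] {G : Type*} [Group G] {W : Type*} [AddCommGroup W] [Module F W]
  {ρ : Representation F G W}

theorem act_eq_symMap (ρ : Representation F G W) (g : G) : act ρ g = symMap (ρ g) := rfl

theorem act_mul (ρ : Representation F G W) (g h : G) (f : SymmetricAlgebra F W) :
    act ρ (g * h) f = act ρ g (act ρ h f) := by
  simp only [act_eq_symMap, symMap_comp, map_mul]
  rfl

theorem act_one (ρ : Representation F G W) (f : SymmetricAlgebra F W) : act ρ 1 f = f := by
  simp only [act_eq_symMap, map_one]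
  exact symMap_id f

@[simp]
theorem act_ι (ρ : Representation F G W) (g : G) (w : W) :
    act ρ g (SymmetricAlgebra.ι F W w) = SymmetricAlgebra.ι F W (ρ g w) := symMap_ι _ _

@[simp]
theorem aug_act (ρ : Representation F G W) (g : G) (f : SymmetricAlgebra F W) :
    aug F W (act ρ g f) = aug F W f := aug_symMap _ _

theorem component_mem_invariants (d : ℕ) {f : SymmetricAlgebra F W} (hf : f ∈ invariants ρ) :
    component F W d f ∈ invariants ρ := by
  rw [mem_invariants] at hf ⊢
  intro g
  rw [act_eq_symMap, ← component_symMap, ← act_eq_symMap, hf]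

/-- The invariants without constant term. -/
noncomputable def posInvariants (ρ : Representation F G W) :
    Submodule F (SymmetricAlgebra F W) :=
  Subalgebra.toSubmodule (invariants ρ) ⊓ LinearMap.ker (aug F W).toLinearMap

theorem mem_posInvariants {f : SymmetricAlgebra F W} :
    f ∈ posInvariants ρ ↔ f ∈ invariants ρ ∧ aug F W f = 0 := Iff.rfl

/-- The span of all products of two invariants without constant term. -/
noncomputable def decomposables (ρ : Representation F G W) :
    Submodule F (SymmetricAlgebra F W) :=
  posInvariants ρ * posInvariants ρ

theorem component_mem_posInvariants {d : ℕ} (hd : d ≠ 0) {f : SymmetricAlgebra F W}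
    (hf : f ∈ invariants ρ) : component F W d f ∈ posInvariants ρ :=
  ⟨component_mem_invariants d hf, aug_of_mem hd (component_mem d f)⟩

/-- Strong induction on the degree: the degree `e` component of a product of two invariants without
constant term involves only factors of degree strictly below `e`. -/
theorem mem_adjoin_of_decomposables {d : ℕ}
    (h : ∀ e > d, ∀ f ∈ invariants ρ, f ∈ homogeneousPart F W e → f ∈ decomposables ρ)
    (e : ℕ) {f : SymmetricAlgebra F W} (hf : f ∈ invariants ρ) (hfe : f ∈ homogeneousPart F W e) :
    f ∈ Algebra.adjoin F {f | f ∈ invariants ρ ∧ f ∈ degreeLE F W d} := by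
  induction e using Nat.strong_induction_on generalizing f with
  | _ e ih =>
  obtain hed | hed := le_or_gt e d
  · exact Algebra.subset_adjoin ⟨hf, homogeneousPart_le_degreeLE hed hfe⟩
  set A := Algebra.adjoin F {f | f ∈ invariants ρ ∧ f ∈ degreeLE F W d}
  have key : decomposables ρ ≤ (Subalgebra.toSubmodule A).comap (component F W e) := by
    refine Submodule.mul_le.2 fun a ha b hb => ?_
    change component F W e (a * b) ∈ A
    rw [component_mul]
    refine sum_mem fun p hp => ?_
    have hp := Finset.HasAntidiagonal.mem_antidiagonal.1 hp
    by_cases h1 : p.1 = 0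
    · rw [h1, component_zero, (mem_posInvariants.1 ha).2]
      simp
    by_cases h2 : p.2 = 0
    · rw [h2, component_zero, (mem_posInvariants.1 hb).2]
      simp
    exact mul_mem (ih p.1 (by omega) (component_mem_invariants _ ha.1) (component_mem _ _))
      (ih p.2 (by omega) (component_mem_invariants _ hb.1) (component_mem _ _))
  have := key (h e hed f hf hfe)
  rwa [Submodule.mem_comap, component_of_mem hfe] at this

/-- In the component of a product, terms with both degrees positive are decomposable outright; the
two extreme terms are scalar multiples of components covered by induction. Invariance is carried
along because the product step needs it. -/
theorem component_mem_decomposables {d e : ℕ} (hde : d < e) {f : SymmetricAlgebra F W}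
    (hf : f ∈ Algebra.adjoin F {f | f ∈ invariants ρ ∧ f ∈ degreeLE F W d}) :
    f ∈ invariants ρ ∧ component F W e f ∈ decomposables ρ := by
  induction hf using Algebra.adjoin_induction with
  | mem x hx =>
    refine ⟨hx.1, ?_⟩
    rw [component_eq_zero_of_mem_degreeLE hde hx.2]
    exact zero_mem _
  | algebraMap r =>
    refine ⟨algebraMap_mem _ r, ?_⟩
    rw [component_of_mem_of_ne (by omega) (algebraMap_mem_homogeneousPart r)]
    exact zero_mem _
  | add x y _ _ hx hy =>
    refine ⟨add_mem hx.1 hy.1, ?_⟩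
    rw [map_add]
    exact add_mem hx.2 hy.2
  | mul x y _ _ hx hy =>
    refine ⟨mul_mem hx.1 hy.1, ?_⟩
    rw [component_mul]
    refine sum_mem fun p hp => ?_
    have hp := Finset.HasAntidiagonal.mem_antidiagonal.1 hp
    by_cases h1 : p.1 = 0
    · have h2 : p.2 = e := by omega
      rw [h1, component_zero, h2, ← Algebra.smul_def]
      exact Submodule.smul_mem _ _ hy.2
    by_cases h2 : p.2 = 0
    · have h1 : p.1 = e := by omega
      rw [h2, component_zero, h1, mul_comm, ← Algebra.smul_def]
      exact Submodule.smul_mem _ _ hx.2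
    exact Submodule.mul_mem_mul (component_mem_posInvariants h1 hx.1)
      (component_mem_posInvariants h2 hy.1)

/-- Graded Nakayama. Its negation supplies the indecomposable witness from which lower bounds start.
-/
theorem generatedInDegreeLE_iff (ρ : Representation F G W) (d : ℕ) :
    GeneratedInDegreeLE ρ d ↔
      ∀ e > d, ∀ f ∈ invariants ρ, f ∈ homogeneousPart F W e → f ∈ decomposables ρ := by
  refine ⟨fun h e he f hf hfe => ?_, fun h => le_antisymm ?_ fun f hf => ?_⟩
  · rw [← h] at hf
    have := (component_mem_decomposables he hf).2
    rwa [component_of_mem hfe] at this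
  · exact Algebra.adjoin_le fun f hf => hf.1
  · rw [← sum_component f]
    exact sum_mem fun e _ =>
      mem_adjoin_of_decomposables h e (component_mem_invariants e hf) (component_mem e f)

theorem GeneratedInDegreeLE.mono {d e : ℕ} (hde : d ≤ e) (h : GeneratedInDegreeLE ρ d) :
    GeneratedInDegreeLE ρ e := by
  rw [generatedInDegreeLE_iff] at h ⊢
  exact fun n hn => h n (by omega)

theorem lt_betaRep_iff (ρ : Representation F G W) (d : ℕ) :
    (d : ℕ∞) < betaRep ρ ↔ ¬ GeneratedInDegreeLE ρ d := by
  constructor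
  · intro h hd
    exact absurd (iInf₂_le (f := fun (d : ℕ) (_ : GeneratedInDegreeLE ρ d) => (d : ℕ∞)) d hd)
      (not_le.2 h)
  · intro h
    refine lt_of_lt_of_le (b := ((d + 1 : ℕ) : ℕ∞)) (by exact_mod_cast Nat.lt_succ_self d)
      (le_iInf₂ fun e he => ?_)
    by_contra! hlt
    exact h (he.mono (by have : e < d + 1 := by exact_mod_cast hlt
                         omega))

theorem betaRep_le_iff (ρ : Representation F G W) (d : ℕ) :
    betaRep ρ ≤ d ↔ GeneratedInDegreeLE ρ d := by
  rw [← not_lt, lt_betaRep_iff, not_not]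

section Equivariant

variable {W' : Type*} [AddCommGroup W'] [Module F W'] {ρ' : Representation F G W'}

theorem symMap_act {φ : W →ₗ[F] W'} {g : G} (hφ : ∀ w, φ (ρ g w) = ρ' g (φ w))
    (f : SymmetricAlgebra F W) : symMap φ (act ρ g f) = act ρ' g (symMap φ f) := by
  simp only [act_eq_symMap, symMap_comp]
  congr 2
  ext w
  exact hφ w

theorem symMap_mem_invariants {φ : W →ₗ[F] W'} (hφ : ∀ g w, φ (ρ g w) = ρ' g (φ w))
    {f : SymmetricAlgebra F W} (hf : f ∈ invariants ρ) : symMap φ f ∈ invariants ρ' := by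
  rw [mem_invariants] at hf ⊢
  intro g
  rw [← symMap_act (hφ g), hf]

theorem symMap_mem_posInvariants {φ : W →ₗ[F] W'} (hφ : ∀ g w, φ (ρ g w) = ρ' g (φ w))
    {f : SymmetricAlgebra F W} (hf : f ∈ posInvariants ρ) : symMap φ f ∈ posInvariants ρ' :=
  ⟨symMap_mem_invariants hφ hf.1, (aug_symMap φ f).trans hf.2⟩

theorem symMap_mem_decomposables {φ : W →ₗ[F] W'} (hφ : ∀ g w, φ (ρ g w) = ρ' g (φ w))
    {f : SymmetricAlgebra F W} (hf : f ∈ decomposables ρ) : symMap φ f ∈ decomposables ρ' := by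
  have : decomposables ρ ≤ (decomposables ρ').comap (symMap φ).toLinearMap := by
    refine Submodule.mul_le.2 fun a ha b hb => ?_
    change symMap φ (a * b) ∈ decomposables ρ'
    rw [map_mul]
    exact Submodule.mul_mem_mul (symMap_mem_posInvariants hφ ha) (symMap_mem_posInvariants hφ hb)
  exact this hf

theorem GeneratedInDegreeLE.of_equiv (φ : W ≃ₗ[F] W') (hφ : ∀ g w, φ (ρ g w) = ρ' g (φ w))
    {d : ℕ} (h : GeneratedInDegreeLE ρ' d) : GeneratedInDegreeLE ρ d := by
  rw [generatedInDegreeLE_iff] at h ⊢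
  intro e he f hf hfe
  have h1 := h e he _ (symMap_mem_invariants (φ := φ.toLinearMap) hφ hf)
    (symMap_mem_homogeneousPart _ hfe)
  have h2 := symMap_mem_decomposables (φ := φ.symm.toLinearMap) (ρ' := ρ)
    (fun g w => by
      apply φ.injective
      simpa using (hφ g (φ.symm w)).symm) h1
  rw [symMap_comp] at h2
  simpa [symMap_id] using h2

end Equivariant

end Invariants

/-- A choice of basis moves the module to coordinate space, which lives in the universe over which
the supremum is taken. -/
theorem betaRep_le_beta {F : Type u} {G : Type v} [Field F] [Group G] {W : Type w}
    [AddCommGroup W] [Module F W] [Module.Finite F W] (ρ : Representation F G W) :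
    betaRep ρ ≤ beta F G := by
  let φ : W ≃ₗ[F] (Fin (Module.finrank F W) → F) := (Module.finBasis F W).equivFun
  let ρ' : Representation F G (Fin (Module.finrank F W) → F) :=
    { toFun g := φ.conj (ρ g)
      map_one' := by ext; simp
      map_mul' a b := by ext; simp [LinearEquiv.conj_apply] }
  have h : betaRep ρ ≤ betaRep ρ' :=
    le_iInf₂ fun d hd => (betaRep_le_iff ρ d).2
      (hd.of_equiv φ fun g w => by simp [ρ', LinearEquiv.conj_apply])
  refine h.trans (le_iSup_of_le (Fin (Module.finrank F W) → F) ?_)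
  exact le_iSup_of_le inferInstance (le_iSup_of_le inferInstance
    (le_iSup_of_le inferInstance (le_iSup_of_le ρ' le_rfl)))

/-! ### The Reynolds operator, the Hilbert ideal and Noether's bound. -/

section Reynolds

variable {F : Type*} [Field F] {G : Type*} [Group G] [Fintype G]
  {W : Type*} [AddCommGroup W] [Module F W]

/-- The Reynolds operator `S(W) → S(W)^G`. -/
noncomputable def reynolds (ρ : Representation F G W) :
    SymmetricAlgebra F W →ₗ[F] SymmetricAlgebra F W :=
  (Fintype.card G : F)⁻¹ • ∑ g : G, (act ρ g).toLinearMap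

theorem reynolds_apply (ρ : Representation F G W) (f : SymmetricAlgebra F W) :
    reynolds ρ f = (Fintype.card G : F)⁻¹ • ∑ g : G, act ρ g f := by
  simp [reynolds]

theorem sum_act_mem_invariants (ρ : Representation F G W) (f : SymmetricAlgebra F W) :
    ∑ g : G, act ρ g f ∈ invariants ρ := by
  rw [mem_invariants]
  intro h
  simp only [map_sum, ← act_mul]
  exact Fintype.sum_equiv (Equiv.mulLeft h) _ _ fun g => rfl

theorem reynolds_mem_invariants (ρ : Representation F G W) (f : SymmetricAlgebra F W) :
    reynolds ρ f ∈ invariants ρ := by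
  rw [reynolds_apply]
  exact Subalgebra.smul_mem _ (sum_act_mem_invariants ρ f) _

theorem reynolds_mul (ρ : Representation F G W) {a : SymmetricAlgebra F W}
    (ha : a ∈ invariants ρ) (f : SymmetricAlgebra F W) :
    reynolds ρ (a * f) = a * reynolds ρ f := by
  simp [reynolds_apply, (mem_invariants ρ a).1 ha, Finset.mul_sum]

theorem reynolds_of_mem (hG : (Fintype.card G : F) ≠ 0) {ρ : Representation F G W}
    {f : SymmetricAlgebra F W} (hf : f ∈ invariants ρ) : reynolds ρ f = f := by
  simp [reynolds_apply, (mem_invariants ρ f).1 hf, ← Nat.cast_smul_eq_nsmul F, smul_smul, hG]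

theorem aug_reynolds (hG : (Fintype.card G : F) ≠ 0) (ρ : Representation F G W)
    (f : SymmetricAlgebra F W) : aug F W (reynolds ρ f) = aug F W f := by
  simp [reynolds_apply, hG]

theorem reynolds_mem_homogeneousPart (ρ : Representation F G W) {d : ℕ}
    {f : SymmetricAlgebra F W} (hf : f ∈ homogeneousPart F W d) :
    reynolds ρ f ∈ homogeneousPart F W d := by
  rw [reynolds_apply]
  exact Submodule.smul_mem _ _ (sum_mem fun g _ => symMap_mem_homogeneousPart _ hf)

/-- The ideal of `S(W)` generated by the invariants without constant term. -/
noncomputable def hilbertIdeal {G : Type*} [Group G] (ρ : Representation F G W) :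
    Ideal (SymmetricAlgebra F W) :=
  Ideal.span (posInvariants ρ)

/-- R is linear over the invariants, so R(p c f) = p R(c f) for a positive invariant p, and R(c f)
again has no constant term. The statement is kept general in `f` so that the coefficient c can be
absorbed into it. -/
theorem reynolds_mul_mem_decomposables (hG : (Fintype.card G : F) ≠ 0)
    {ρ : Representation F G W} {a f : SymmetricAlgebra F W} (ha : a ∈ hilbertIdeal ρ)
    (hf : aug F W f = 0) : reynolds ρ (a * f) ∈ decomposables ρ := by
  induction ha using Submodule.span_induction generalizing f with
  | mem x hx =>
    rw [reynolds_mul ρ hx.1]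
    exact Submodule.mul_mem_mul hx ⟨reynolds_mem_invariants ρ f, (aug_reynolds hG ρ f).trans hf⟩
  | zero => simp
  | add x y _ _ hx hy =>
    rw [add_mul, map_add]
    exact add_mem (hx hf) (hy hf)
  | smul c x _ hx =>
    rw [smul_eq_mul, mul_comm c, mul_assoc]
    exact hx (by rw [map_mul, hf, mul_zero])

/-- An invariant of degree above `d` is its own Reynolds image and a sum of products of a degree `d`
factor, lying in the Hilbert ideal, with a factor of positive degree. -/
theorem generatedInDegreeLE_of_le_hilbertIdeal (hG : (Fintype.card G : F) ≠ 0)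
    {ρ : Representation F G W} {d : ℕ} (h : ∀ f ∈ homogeneousPart F W d, f ∈ hilbertIdeal ρ) :
    GeneratedInDegreeLE ρ d := by
  rw [generatedInDegreeLE_iff]
  intro e he f hf hfe
  obtain ⟨k, rfl⟩ : ∃ k, e = d + (k + 1) := ⟨e - d - 1, by omega⟩
  have key : homogeneousPart F W d * homogeneousPart F W (k + 1) ≤
      (decomposables ρ).comap (reynolds ρ) :=
    Submodule.mul_le.2 fun a ha b hb =>
      reynolds_mul_mem_decomposables hG (h a ha) (aug_of_mem k.succ_ne_zero hb)
  rw [← reynolds_of_mem hG hf]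
  refine key ?_
  rwa [homogeneousPart, homogeneousPart, ← pow_add]

/-- Benson's trick. With y_g = g⁻¹ x_g, the product over g of (h y_g - x_g) vanishes for each h
because of its factor g = h. Expanding and summing over h, each term with a nonempty set of y's
carries an orbit sum of positive degree; what remains is ±|G| times the desired product. -/
theorem prod_ι_mem_hilbertIdeal (hG : (Fintype.card G : F) ≠ 0) (ρ : Representation F G W)
    (x : G → W) : ∏ g : G, SymmetricAlgebra.ι F W (x g) ∈ hilbertIdeal ρ := by
  classical
  let y : G → SymmetricAlgebra F W := fun g => SymmetricAlgebra.ι F W (ρ g⁻¹ (x g))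
  let z : G → SymmetricAlgebra F W := fun g => SymmetricAlgebra.ι F W (x g)
  have hyz (h : G) : act ρ h (y h) = z h := by
    simp only [y, z, act_ι, ← Module.End.mul_apply, ← map_mul]
    simp
  have h0 : ∑ h : G, ∏ g : G, (act ρ h (y g) + -z g) = 0 :=
    Finset.sum_eq_zero fun h _ => Finset.prod_eq_zero (Finset.mem_univ h) (by rw [hyz]; ring)
  simp only [Fintype.prod_add] at h0
  rw [Finset.sum_comm, ← Finset.add_sum_erase _ _ (Finset.mem_univ ∅)] at h0
  have h1 : ∑ A ∈ Finset.univ.erase (∅ : Finset G),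
      ∑ h : G, (∏ g ∈ A, act ρ h (y g)) * ∏ g ∈ Aᶜ, (-z g) ∈ hilbertIdeal ρ := by
    refine sum_mem fun A hA => ?_
    rw [← Finset.sum_mul]
    refine Ideal.mul_mem_right _ _ (Ideal.subset_span ⟨?_, ?_⟩)
    · simp only [← map_prod]
      exact sum_act_mem_invariants ρ _
    · obtain ⟨a, ha⟩ := Finset.nonempty_iff_ne_empty.2 (Finset.ne_of_mem_erase hA)
      change aug F W _ = 0
      simp only [← map_prod, map_sum, aug_act]
      refine Finset.sum_eq_zero fun h _ => ?_
      rw [map_prod]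
      exact Finset.prod_eq_zero ha (aug_ι _)
  have h2 := (Submodule.add_mem_iff_left _ h1).1 (h0 ▸ zero_mem _)
  have h3 : ∑ h : G, (∏ g ∈ (∅ : Finset G), act ρ h (y g)) * ∏ g ∈ (∅ : Finset G)ᶜ, (-z g) =
      algebraMap F (SymmetricAlgebra F W) ((Fintype.card G : F) * (-1) ^ Fintype.card G) *
        ∏ g : G, z g := by
    simp [Finset.prod_neg, mul_assoc]
  rw [h3] at h2
  refine (Ideal.unit_mul_mem_iff_mem _ (RingHom.isUnit_map _ (IsUnit.mk0 _ ?_))).1 h2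
  exact mul_ne_zero hG (pow_ne_zero _ (neg_ne_zero.2 one_ne_zero))

theorem homogeneousPart_card_le_hilbertIdeal (hG : (Fintype.card G : F) ≠ 0)
    (ρ : Representation F G W) {f : SymmetricAlgebra F W}
    (hf : f ∈ homogeneousPart F W (Fintype.card G)) : f ∈ hilbertIdeal ρ := by
  rw [homogeneousPart, Submodule.pow_eq_span_pow_set] at hf
  induction hf using Submodule.span_induction with
  | mem x hx =>
    obtain ⟨c, rfl⟩ := Set.mem_pow.1 hx
    choose w hw using fun i => (c i).2
    rw [List.prod_ofFn, ← Equiv.prod_comp (Fintype.equivFin G)]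
    simp only [← hw]
    exact prod_ι_mem_hilbertIdeal hG ρ _
  | zero => exact zero_mem _
  | add x y _ _ hx hy => exact add_mem hx hy
  | smul r x _ hx => exact Submodule.smul_of_tower_mem _ r hx

end Reynolds

/-- Noether's degree bound in the non-modular case. -/
theorem beta_le_card {F : Type u} {G : Type v} [Field F] [Group G] [Fintype G]
    (hG : (Fintype.card G : F) ≠ 0) : beta F G ≤ Fintype.card G :=
  iSup_le fun _ => iSup_le fun _ => iSup_le fun _ => iSup_le fun _ => iSup_le fun ρ =>
    (betaRep_le_iff ρ _).2 (generatedInDegreeLE_of_le_hilbertIdeal hG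
      fun _ => homogeneousPart_card_le_hilbertIdeal hG ρ)

/-! ### The lower bound from coinvariants relative to a subgroup. -/

section RelativeCoinvariants

variable {F : Type*} [Field F] {G : Type*} [Group G] {V : Type*} [AddCommGroup V] [Module F V]

/-- The restriction of a representation to a subgroup. -/
def restrict (ρ : Representation F G V) (K : Subgroup G) : Representation F K V :=
  ρ.comp K.subtype

/-- The permutation representation of `G` on the functions on `G ⧸ K`. -/
def cosetRep (F : Type*) [Field F] {G : Type*} [Group G] (K : Subgroup G) :
    Representation F G (G ⧸ K → F) where
  toFun g := LinearMap.funLeft F F (g⁻¹ • ·)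
  map_one' := by ext; simp [LinearMap.funLeft_apply]
  map_mul' g h := by ext; simp [LinearMap.funLeft_apply, mul_smul]

@[simp]
theorem cosetRep_apply (K : Subgroup G) (g : G) (p : G ⧸ K → F) (c : G ⧸ K) :
    cosetRep F K g p c = p (g⁻¹ • c) := rfl

open Polynomial in
/-- The algebra homomorphism `S(V × (G ⧸ K → F)) → S(V)[X]` sending `(v, p)` to `v + p(K) X`. -/
noncomputable def cosetCoeffs (F : Type*) [Field F] {G : Type*} [Group G] (K : Subgroup G)
    (V : Type*) [AddCommGroup V] [Module F V] :
    SymmetricAlgebra F (V × (G ⧸ K → F)) →ₐ[F] (SymmetricAlgebra F V)[X] :=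
  SymmetricAlgebra.lift (LinearMap.coprod
    (((monomial 0).restrictScalars F) ∘ₗ SymmetricAlgebra.ι F V)
    (((monomial 1).restrictScalars F) ∘ₗ (Algebra.linearMap F (SymmetricAlgebra F V)) ∘ₗ
      LinearMap.proj ((1 : G) : G ⧸ K)))

variable (K : Subgroup G)

@[simp]
theorem cosetCoeffs_ι (v : V) (p : G ⧸ K → F) :
    cosetCoeffs F K V (SymmetricAlgebra.ι F _ (v, p)) =
      Polynomial.monomial 0 (SymmetricAlgebra.ι F V v) +
        Polynomial.monomial 1 (algebraMap F (SymmetricAlgebra F V) (p ((1 : G) : G ⧸ K))) := by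
  simp [cosetCoeffs]

theorem coeff_zero_cosetCoeffs (f : SymmetricAlgebra F (V × (G ⧸ K → F))) :
    (cosetCoeffs F K V f).coeff 0 = symMap (LinearMap.fst F V _) f := by
  induction f using SymmetricAlgebra.induction with
  | algebraMap r => simp [Polynomial.algebraMap_apply]
  | ι w => obtain ⟨v, p⟩ := w; simp [Polynomial.coeff_monomial]
  | mul a b ha hb => simp [Polynomial.mul_coeff_zero, ha, hb]
  | add a b ha hb => simp [ha, hb]

theorem cosetCoeffs_inl (f : SymmetricAlgebra F V) :
    cosetCoeffs F K V (symMap (LinearMap.inl F V _) f) = Polynomial.C f := by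
  have : (cosetCoeffs F K V).comp (symMap (LinearMap.inl F V _)) =
      (Algebra.ofId (SymmetricAlgebra F V) _).restrictScalars F := by
    ext w : 2; simp [Algebra.ofId_apply]
  exact congr($this f)

/-- Only the value at the coset K is retained, and K is its stabiliser; this is why equivariance
holds for K alone. -/
theorem cosetCoeffs_act (ρ : Representation F G V) {k : G} (hk : k ∈ K)
    (f : SymmetricAlgebra F (V × (G ⧸ K → F))) :
    cosetCoeffs F K V (act (ρ.prod (cosetRep F K)) k f) =
      Polynomial.mapAlgHom (act ρ k) (cosetCoeffs F K V f) := by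
  have hk1 : k⁻¹ • ((1 : G) : G ⧸ K) = ((1 : G) : G ⧸ K) := by
    rw [MulAction.Quotient.smul_coe, QuotientGroup.eq]
    simpa using hk
  have : (cosetCoeffs F K V).comp (act (ρ.prod (cosetRep F K)) k) =
      (Polynomial.mapAlgHom (act ρ k)).comp (cosetCoeffs F K V) := by
    refine SymmetricAlgebra.algHom_ext (LinearMap.ext fun w => ?_)
    obtain ⟨v, p⟩ := w
    simp [hk1]
  exact congr($this f)

variable {K}

/-- Product rule: the linear coefficient of ab is a₀b₁ + b₀a₁, where constant coefficients are
positive G-invariants and linear ones are K-invariants. -/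
theorem coeff_one_mem_of_mem_decomposables {ρ : Representation F G V}
    {f : SymmetricAlgebra F (V × (G ⧸ K → F))} (hf : f ∈ decomposables (ρ.prod (cosetRep F K))) :
    (cosetCoeffs F K V f).coeff 1 ∈
      posInvariants ρ * Subalgebra.toSubmodule (invariants (restrict ρ K)) := by
  have h0 {a} (ha : a ∈ posInvariants (ρ.prod (cosetRep F K))) :
      (cosetCoeffs F K V a).coeff 0 ∈ posInvariants ρ := by
    rw [coeff_zero_cosetCoeffs]
    exact symMap_mem_posInvariants (fun _ _ => rfl) ha
  have h1 {a} (ha : a ∈ posInvariants (ρ.prod (cosetRep F K))) :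
      (cosetCoeffs F K V a).coeff 1 ∈ invariants (restrict ρ K) := by
    rw [mem_invariants]
    intro k
    have := cosetCoeffs_act K ρ k.2 a
    rw [(mem_invariants _ a).1 ha.1] at this
    conv_rhs => rw [this]
    simp only [Polynomial.coe_mapAlgHom, Polynomial.coeff_map]
    rfl
  have key : decomposables (ρ.prod (cosetRep F K)) ≤
      (posInvariants ρ * Subalgebra.toSubmodule (invariants (restrict ρ K))).comap
        (((Polynomial.lcoeff _ 1).restrictScalars F) ∘ₗ (cosetCoeffs F K V).toLinearMap) := by
    refine Submodule.mul_le.2 fun a ha b hb => ?_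
    change (cosetCoeffs F K V (a * b)).coeff 1 ∈
      posInvariants ρ * Subalgebra.toSubmodule (invariants (restrict ρ K))
    rw [map_mul, Polynomial.mul_coeff_one, mul_comm _ (Polynomial.coeff _ 0)]
    exact add_mem (Submodule.mul_mem_mul (h0 ha) (h1 hb)) (Submodule.mul_mem_mul (h0 hb) (h1 ha))
  exact key hf

end RelativeCoinvariants

/-- A relative version of the comparison between the Noether number and the top degree of the
coinvariants: the latter is the case of the trivial subgroup. -/
theorem succ_le_beta {F : Type u} {G : Type v} [Field F] [Group G] [Fintype G]
    (hG : (Fintype.card G : F) ≠ 0) {V : Type w} [AddCommGroup V] [Module F V] [Module.Finite F V]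
    {ρ : Representation F G V} {K : Subgroup G} {d : ℕ} {s : SymmetricAlgebra F V}
    (hs : s ∈ homogeneousPart F V d) (hinv : s ∈ invariants (restrict ρ K))
    (hnot : s ∉ posInvariants ρ * Subalgebra.toSubmodule (invariants (restrict ρ K))) :
    ((d + 1 : ℕ) : ℕ∞) ≤ beta F G := by
  classical
  have hK : (Nat.card K : F) ≠ 0 := by
    obtain ⟨c, hc⟩ := K.card_subgroup_dvd_card
    rw [Nat.card_eq_fintype_card] at hc
    rw [hc, Nat.cast_mul] at hG
    exact left_ne_zero_of_mul hG
  let x : SymmetricAlgebra F (V × (G ⧸ K → F)) :=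
    SymmetricAlgebra.ι F _ (0, Pi.single ((1 : G) : G ⧸ K) 1)
  let i := symMap (LinearMap.inl F V (G ⧸ K → F))
  let σ := ρ.prod (cosetRep F K)
  have hi (g : G) : act σ g (i s) = i (act ρ g s) :=
    (symMap_act (fun v => by simp [σ]) s).symm
  -- For g ∉ K, the translate of x is the indicator of another coset and is killed; for g ∈ K both s
  -- and x are fixed.
  have hcoeff (g : G) : (cosetCoeffs F K V (act σ g (i s * x))).coeff 1 =
      if g ∈ K then s else 0 := by
    have hg : ((1 : G) : G ⧸ K) = g⁻¹ • ((1 : G) : G ⧸ K) ↔ g ∈ K := by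
      rw [MulAction.Quotient.smul_coe, QuotientGroup.eq]
      simp
    rw [map_mul, map_mul, hi, cosetCoeffs_inl, act_ι, Polynomial.coeff_C_mul]
    simp only [σ, Representation.prod_apply_apply, cosetCoeffs_ι, map_zero, cosetRep_apply,
      Polynomial.coeff_add, Polynomial.coeff_monomial, Polynomial.coeff_zero, Pi.single_apply,
      eq_comm (a := g⁻¹ • ((1 : G) : G ⧸ K)), hg]
    by_cases h : g ∈ K
    · have hgs : act ρ g s = s := (mem_invariants _ s).1 hinv ⟨g, h⟩
      simp [h, hgs]
    · simp [h]
  have hsum : (cosetCoeffs F K V (reynolds σ (i s * x))).coeff 1 =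
      ((Fintype.card G : F)⁻¹ * Nat.card K) • s := by
    rw [reynolds_apply, map_smul, map_sum, Polynomial.coeff_smul, Polynomial.finsetSum_coeff]
    simp only [hcoeff]
    rw [← Finset.sum_filter, Finset.sum_const, mul_smul, Nat.cast_smul_eq_nsmul,
      Nat.card_eq_fintype_card, Fintype.card_subtype]
  refine le_trans ?_ (betaRep_le_beta σ)
  rw [Nat.cast_add, Nat.cast_one, ENat.add_one_le_iff (ENat.natCast_ne_top d), lt_betaRep_iff,
    generatedInDegreeLE_iff]
  intro h
  have h1 := coeff_one_mem_of_mem_decomposables (h (d + 1) (Nat.lt_succ_self d) _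
    (reynolds_mem_invariants σ (i s * x)) (reynolds_mem_homogeneousPart σ
      (mul_mem_homogeneousPart (symMap_mem_homogeneousPart _ hs) (ι_mem_homogeneousPart _))))
  rw [hsum] at h1
  exact hnot ((Submodule.smul_mem_iff _ (mul_ne_zero (inv_ne_zero hG) hK)).1 h1)

/-! ### Coinduced modules and proper subgroups. -/

section Coinduction

variable {F : Type*} [Field F] {G : Type*} [Group G] {K : Subgroup G}
  {W : Type*} [AddCommGroup W] [Module F W]

/-- The evaluation at `x ∈ G` of the elements of the coinduced representation, which are the
equivariant functions from `G` to `W`. -/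
def coindEval (ρ : Representation F K W) (x : G) :
    Representation.coindV K.subtype ρ →ₗ[F] W :=
  LinearMap.proj x ∘ₗ Submodule.subtype _

@[simp]
theorem coindEval_apply (ρ : Representation F K W) (x : G)
    (φ : Representation.coindV K.subtype ρ) : coindEval ρ x φ = φ.1 x := rfl

open Classical in
/-- The embedding of `W` into the coinduced representation as the functions supported on `K`. -/
noncomputable def coindIncl (ρ : Representation F K W) :
    W →ₗ[F] Representation.coindV K.subtype ρ where
  toFun w := ⟨fun x => if h : x ∈ K then ρ ⟨x, h⟩ w else 0, by
    intro k x
    by_cases h : x ∈ K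
    · have : (⟨k * x, K.mul_mem k.2 h⟩ : K) = k * ⟨x, h⟩ := rfl
      simp [h, this, K.mul_mem_cancel_left k.2]
    · simp [h, K.mul_mem_cancel_left k.2]⟩
  map_add' a b := by
    ext x
    by_cases h : x ∈ K <;> simp [h]
  map_smul' c a := by
    ext x
    by_cases h : x ∈ K <;> simp [h]

theorem coindEval_one_comp_coindIncl (ρ : Representation F K W) :
    coindEval ρ 1 ∘ₗ coindIncl ρ = LinearMap.id := by
  have : (⟨1, K.one_mem⟩ : K) = 1 := rfl
  ext w
  simp [coindIncl, K.one_mem, this]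

theorem coindEval_comp_coindIncl (ρ : Representation F K W) {x : G} (hx : x ∉ K) :
    coindEval ρ x ∘ₗ coindIncl ρ = 0 := by
  ext w
  simp [coindIncl, hx]

theorem coindEval_coind (ρ : Representation F K W) (x g : G)
    (φ : Representation.coindV K.subtype ρ) :
    coindEval ρ x (Representation.coind K.subtype ρ g φ) = coindEval ρ (x * g) φ := rfl

theorem coindEval_one_coind (ρ : Representation F K W) (k : K)
    (φ : Representation.coindV K.subtype ρ) :
    coindEval ρ 1 (Representation.coind K.subtype ρ k φ) = ρ k (coindEval ρ 1 φ) := by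
  rw [coindEval_coind, one_mul]
  simpa using φ.2 k 1

theorem coindIncl_apply (ρ : Representation F K W) (k : K) (w : W) :
    coindIncl ρ (ρ k w) = restrict (Representation.coind K.subtype ρ) K k (coindIncl ρ w) := by
  refine Subtype.ext (funext fun x => ?_)
  change _ = (coindIncl ρ w).1 (x * k)
  by_cases h : x ∈ K
  · have : (⟨x * k, K.mul_mem h k.2⟩ : K) = ⟨x, h⟩ * k := rfl
    simp [coindIncl, h, this, K.mul_mem_cancel_right k.2]
  · simp [coindIncl, h, K.mul_mem_cancel_right k.2]

/-- Evaluation at x is evaluation at 1 after translating by x, and translation does not move a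
G-invariant. -/
theorem symMap_coindEval_of_mem_invariants {ρ : Representation F K W} (x : G)
    {a : SymmetricAlgebra F (Representation.coindV K.subtype ρ)}
    (ha : a ∈ invariants (Representation.coind K.subtype ρ)) :
    symMap (coindEval ρ x) a = symMap (coindEval ρ 1) a := by
  conv_rhs => rw [← (mem_invariants _ a).1 ha x, act_eq_symMap, symMap_comp]
  congr 2
  ext φ
  simp only [LinearMap.comp_apply, coindEval_coind, one_mul]

theorem symMap_coindEval_one_mem_invariants {ρ : Representation F K W}
    {a : SymmetricAlgebra F (Representation.coindV K.subtype ρ)}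
    (ha : a ∈ invariants (restrict (Representation.coind K.subtype ρ) K)) :
    symMap (coindEval ρ 1) a ∈ invariants ρ :=
  symMap_mem_invariants (fun k φ => coindEval_one_coind ρ k φ) ha

theorem invariants_le_invariants_restrict {V : Type*} [AddCommGroup V] [Module F V]
    (ρ : Representation F G V) (K : Subgroup G) : invariants ρ ≤ invariants (restrict ρ K) :=
  fun f hf => (mem_invariants _ f).2 fun k => (mem_invariants ρ f).1 hf k

/-- For x ∉ K, apply ev₁ - R ∘ ev_x. The image of f goes to f, since ev_x kills the copy of W and f
has no constant term. A product ab with a a positive G-invariant goes to ev₁(a) (ev₁(b) -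
R(ev_x(b))), and the subtraction removes the constant term of the second factor, making the product
decomposable. -/
theorem mem_decomposables_of_symMap_coindIncl [Fintype K] (hK : (Fintype.card K : F) ≠ 0)
    (hne : K ≠ ⊤) {ρ : Representation F K W} {f : SymmetricAlgebra F W} (hf : aug F W f = 0)
    (h : symMap (coindIncl ρ) f ∈ posInvariants (Representation.coind K.subtype ρ) *
      Subalgebra.toSubmodule (invariants (restrict (Representation.coind K.subtype ρ) K))) :
    f ∈ decomposables ρ := by
  obtain ⟨x, hx⟩ : ∃ x, x ∉ K := by
    by_contra! hall
    exact hne ((Subgroup.eq_top_iff' K).2 hall)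
  have key : posInvariants (Representation.coind K.subtype ρ) *
      Subalgebra.toSubmodule (invariants (restrict (Representation.coind K.subtype ρ) K)) ≤
      (decomposables ρ).comap ((symMap (coindEval ρ 1)).toLinearMap -
        reynolds ρ ∘ₗ (symMap (coindEval ρ x)).toLinearMap) := by
    refine Submodule.mul_le.2 fun a ha b hb => ?_
    change symMap (coindEval ρ 1) (a * b) - reynolds ρ (symMap (coindEval ρ x) (a * b)) ∈
      decomposables ρ
    have hpa : symMap (coindEval ρ 1) a ∈ invariants ρ :=
      symMap_coindEval_one_mem_invariants (invariants_le_invariants_restrict _ K ha.1)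
    rw [map_mul, map_mul, symMap_coindEval_of_mem_invariants x ha.1, reynolds_mul ρ hpa, ← mul_sub]
    refine Submodule.mul_mem_mul ⟨hpa, (aug_symMap _ a).trans ha.2⟩ ⟨?_, ?_⟩
    · exact sub_mem (symMap_coindEval_one_mem_invariants hb) (reynolds_mem_invariants ρ _)
    · change aug F W _ = 0
      rw [map_sub, aug_reynolds hK, aug_symMap, aug_symMap, sub_self]
  have h1 := key h
  rw [Submodule.mem_comap] at h1
  simpa [symMap_comp, coindEval_one_comp_coindIncl, coindEval_comp_coindIncl ρ hx, symMap_id,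
    symMap_zero, hf] using h1

end Coinduction

/-- The constant 1 is never in the span of multiples of positive invariants. Positivity is what
allows Noether numbers to be written as successors. -/
theorem one_le_beta (F : Type u) (G : Type v) [Field F] [Group G] [Fintype G]
    (hG : (Fintype.card G : F) ≠ 0) : 1 ≤ beta F G := by
  let ρ : Representation F G F := 1
  refine succ_le_beta (d := 0) (s := 1) (K := ⊤) (ρ := ρ) hG
    (by simpa using algebraMap_mem_homogeneousPart (W := F) (1 : F)) (one_mem _) fun h => ?_
  have key : posInvariants ρ * Subalgebra.toSubmodule (invariants (restrict ρ ⊤)) ≤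
      LinearMap.ker (aug F F).toLinearMap := by
    refine Submodule.mul_le.2 fun a ha b _ => ?_
    change aug F F (a * b) = 0
    rw [map_mul, (mem_posInvariants.1 ha).2, zero_mul]
  have h1 : aug F F 1 = 0 := key h
  simp at h1

theorem exists_lt_betaRep {F : Type u} {G : Type v} [Field F] [Group G] {d : ℕ∞}
    (h : d < beta F G) : ∃ (W : Type u) (_ : AddCommGroup W) (_ : Module F W)
      (_ : Module.Finite F W) (ρ : Representation F G W), d < betaRep ρ := by
  simpa only [beta, lt_iSup_iff] using h

/-- One unit comes from the witness having degree at least `d + 1`, the other from the coset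
variable adjoined in `succ_le_beta`. -/
theorem add_two_le_beta {F : Type u} {G : Type v} [Field F] [Group G] [Fintype G]
    (hG : (Fintype.card G : F) ≠ 0) {K : Subgroup G} [Fintype K]
    (hK : (Fintype.card K : F) ≠ 0) (hne : K ≠ ⊤) {d : ℕ} (hd : (d : ℕ∞) < beta F K) :
    ((d + 2 : ℕ) : ℕ∞) ≤ beta F G := by
  obtain ⟨W, _, _, _, ρ, hρ⟩ := exists_lt_betaRep hd
  rw [lt_betaRep_iff, generatedInDegreeLE_iff] at hρ
  push Not at hρ
  obtain ⟨e, he, f, hf, hfe, hdec⟩ := hρ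
  refine le_trans ?_ (succ_le_beta hG (ρ := Representation.coind K.subtype ρ) (K := K)
    (symMap_mem_homogeneousPart (coindIncl ρ) hfe)
    (symMap_mem_invariants (coindIncl_apply ρ) hf)
    fun h => hdec (mem_decomposables_of_symMap_coindIncl hK hne (aug_of_mem (by omega) hfe) h))
  exact_mod_cast (by omega : d + 2 ≤ e + 1)

/-! ### Pure tensors modulo a pair of ideals. -/

section TensorIdeal

open TensorProduct

theorem tmul_ne_zero {F M N : Type*} [Field F] [AddCommGroup M] [Module F M] [AddCommGroup N]
    [Module F N] {x : M} {y : N} (hx : x ≠ 0) (hy : y ≠ 0) : TensorProduct.tmul F x y ≠ 0 := by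
  obtain ⟨l, hl⟩ : ∃ l : Module.Dual F M, l x ≠ 0 := by
    by_contra! h
    exact hx ((Module.forall_dual_apply_eq_zero_iff F x).1 h)
  obtain ⟨m, hm⟩ : ∃ m : Module.Dual F N, m y ≠ 0 := by
    by_contra! h
    exact hy ((Module.forall_dual_apply_eq_zero_iff F y).1 h)
  intro h
  have := congr(TensorProduct.lid F F (TensorProduct.map l m $h))
  simp [hl, hm] at this

/-- The kernel of `A ⊗ B → (A ⧸ I) ⊗ (B ⧸ J)`. -/
noncomputable def tensorIdeal (F : Type*) [Field F] {A B : Type*} [CommRing A] [Algebra F A]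
    [CommRing B] [Algebra F B] (I : Ideal A) (J : Ideal B) : Ideal (A ⊗[F] B) :=
  RingHom.ker (Algebra.TensorProduct.map (Ideal.Quotient.mkₐ F I) (Ideal.Quotient.mkₐ F J))

variable {F : Type*} [Field F] {A B : Type*} [CommRing A] [Algebra F A] [CommRing B] [Algebra F B]
  {I : Ideal A} {J : Ideal B} {a : A} {b : B}

theorem tmul_mem_tensorIdeal_left (ha : a ∈ I) (b : B) : a ⊗ₜ b ∈ tensorIdeal F I J := by
  rw [tensorIdeal, RingHom.mem_ker, Algebra.TensorProduct.map_tmul, Ideal.Quotient.mkₐ_eq_mk,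
    Ideal.Quotient.eq_zero_iff_mem.2 ha, zero_tmul]

theorem tmul_mem_tensorIdeal_right (a : A) (hb : b ∈ J) : a ⊗ₜ b ∈ tensorIdeal F I J := by
  rw [tensorIdeal, RingHom.mem_ker, Algebra.TensorProduct.map_tmul, Ideal.Quotient.mkₐ_eq_mk F J,
    Ideal.Quotient.eq_zero_iff_mem.2 hb, tmul_zero]

theorem tmul_notMem_tensorIdeal (ha : a ∉ I) (hb : b ∉ J) : a ⊗ₜ b ∉ tensorIdeal F I J := by
  rw [tensorIdeal, RingHom.mem_ker, Algebra.TensorProduct.map_tmul]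
  exact tmul_ne_zero (mt Ideal.Quotient.eq_zero_iff_mem.1 ha)
    (mt Ideal.Quotient.eq_zero_iff_mem.1 hb)

end TensorIdeal

/-! ### Normal subgroups: evaluation into the tensor product of two symmetric algebras. -/

section Normal

open TensorProduct

variable {F : Type*} [Field F] {G : Type*} [Group G] {N : Subgroup G}
  {W : Type*} [AddCommGroup W] [Module F W] {U : Type*} [AddCommGroup U] [Module F U]

/-- The representation of `G` on the product of the module coinduced from the `N`-module `W` and
of the `G ⧸ N`-module `U`. -/
noncomputable def coindProd [N.Normal] (ρ : Representation F N W) (τ : Representation F (G ⧸ N) U) :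
    Representation F G (Representation.coindV N.subtype ρ × U) :=
  (Representation.coind N.subtype ρ).prod (τ.comp (QuotientGroup.mk' N))

/-- The algebra homomorphism from the symmetric algebra of `coindProd ρ τ` to `S(W) ⊗ S(U)` given
by the evaluation at `1`. -/
noncomputable def coindProdEval (ρ : Representation F N W) (U : Type*) [AddCommGroup U]
    [Module F U] : SymmetricAlgebra F (Representation.coindV N.subtype ρ × U) →ₐ[F]
      SymmetricAlgebra F W ⊗[F] SymmetricAlgebra F U :=
  SymmetricAlgebra.lift (LinearMap.coprod
    (Algebra.TensorProduct.includeLeft.toLinearMap ∘ₗ SymmetricAlgebra.ι F W ∘ₗ coindEval ρ 1)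
    (Algebra.TensorProduct.includeRight.toLinearMap ∘ₗ SymmetricAlgebra.ι F U))

@[simp]
theorem coindProdEval_ι (ρ : Representation F N W) (φ : Representation.coindV N.subtype ρ)
    (u : U) : coindProdEval ρ U (SymmetricAlgebra.ι F _ (φ, u)) =
      SymmetricAlgebra.ι F W (φ.1 1) ⊗ₜ 1 + 1 ⊗ₜ SymmetricAlgebra.ι F U u := by
  simp [coindProdEval]

/-- N acts trivially on U, and evaluation at 1 is N-equivariant, so only the left factor feels the
action. -/
theorem coindProdEval_act [N.Normal] (ρ : Representation F N W)
    (τ : Representation F (G ⧸ N) U) (k : N)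
    (a : SymmetricAlgebra F (Representation.coindV N.subtype ρ × U)) :
    coindProdEval ρ U (act (coindProd ρ τ) k a) =
      Algebra.TensorProduct.map (act ρ k) (AlgHom.id F _) (coindProdEval ρ U a) := by
  have h : (coindProdEval ρ U).comp (act (coindProd ρ τ) k) =
      (Algebra.TensorProduct.map (act ρ k) (AlgHom.id F _)).comp (coindProdEval ρ U) := by
    refine SymmetricAlgebra.algHom_ext (LinearMap.ext fun w => ?_)
    obtain ⟨φ, u⟩ := w
    have h1 : ((k : G) : G ⧸ N) = 1 := (QuotientGroup.eq_one_iff _).2 k.2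
    have h2 := coindEval_one_coind ρ k φ
    rw [coindEval_apply, coindEval_apply] at h2
    have h3 : coindProd ρ τ k (φ, u) = (Representation.coind N.subtype ρ k φ, u) := by
      simp [coindProd, h1]
    change coindProdEval ρ U (act (coindProd ρ τ) k (SymmetricAlgebra.ι F _ (φ, u))) =
      Algebra.TensorProduct.map (act ρ k) (AlgHom.id F _)
        (coindProdEval ρ U (SymmetricAlgebra.ι F _ (φ, u)))
    rw [act_ι, h3, coindProdEval_ι, h2]
    simp
  exact congr($h a)

/-- The algebra homomorphism `S(W) ⊗ S(U) → S(U)` given by the augmentation of `S(W)`. -/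
noncomputable def augLeft (F W U : Type*) [Field F] [AddCommGroup W] [Module F W] [AddCommGroup U]
    [Module F U] : SymmetricAlgebra F W ⊗[F] SymmetricAlgebra F U →ₐ[F] SymmetricAlgebra F U :=
  (Algebra.TensorProduct.lid F _).toAlgHom.comp
    (Algebra.TensorProduct.map (aug F W) (AlgHom.id F _))

@[simp]
theorem augLeft_tmul (a : SymmetricAlgebra F W) (b : SymmetricAlgebra F U) :
    augLeft F W U (a ⊗ₜ b) = aug F W a • b := by
  simp [augLeft]

theorem augLeft_coindProdEval (ρ : Representation F N W)
    (a : SymmetricAlgebra F (Representation.coindV N.subtype ρ × U)) :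
    augLeft F W U (coindProdEval ρ U a) = symMap (LinearMap.snd F _ U) a := by
  have h : (augLeft F W U).comp (coindProdEval ρ U) = symMap (LinearMap.snd F _ U) := by
    refine SymmetricAlgebra.algHom_ext (LinearMap.ext fun w => ?_)
    obtain ⟨φ, u⟩ := w
    simp
  exact congr($h a)

/-- The ideal of `S(W) ⊗ S(U)` generated by the Hilbert ideals of two representations on `W` and
on `U`. -/
noncomputable def hilbertTensorIdeal {H H' : Type*} [Group H] [Group H'] (ρ : Representation F H W)
    (τ : Representation F H' U) : Ideal (SymmetricAlgebra F W ⊗[F] SymmetricAlgebra F U) :=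
  tensorIdeal F (hilbertIdeal ρ) (hilbertIdeal τ)

/-- Modulo the Hilbert ideal, the Reynolds image of an element is just its constant term. -/
theorem rTensor_reynolds_sub_mem {H H' : Type*} [Group H] [Fintype H] [Group H']
    (hH : (Fintype.card H : F) ≠ 0) (ρ : Representation F H W) (τ : Representation F H' U)
    (t : SymmetricAlgebra F W ⊗[F] SymmetricAlgebra F U) :
    (reynolds ρ).rTensor _ t - 1 ⊗ₜ augLeft F W U t ∈ hilbertTensorIdeal ρ τ := by
  induction t using TensorProduct.induction_on with
  | zero => simp
  | tmul a b =>
    have h : reynolds ρ a - algebraMap F _ (aug F W a) ∈ posInvariants ρ := by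
      refine ⟨sub_mem (reynolds_mem_invariants ρ a) ((invariants ρ).algebraMap_mem _), ?_⟩
      change aug F W _ = 0
      simp [aug_reynolds hH]
    rw [LinearMap.rTensor_tmul, augLeft_tmul, ← TensorProduct.smul_tmul,
      ← Algebra.algebraMap_eq_smul_one, ← TensorProduct.sub_tmul]
    exact tmul_mem_tensorIdeal_left (Ideal.subset_span h) b
  | add x y hx hy =>
    rw [map_add, map_add, tmul_add, add_sub_add_comm]
    exact add_mem hx hy

theorem rTensor_reynolds_coindProdEval [N.Normal] [Fintype N] (hN : (Fintype.card N : F) ≠ 0)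
    (ρ : Representation F N W) (τ : Representation F (G ⧸ N) U)
    {a : SymmetricAlgebra F (Representation.coindV N.subtype ρ × U)}
    (ha : a ∈ invariants (coindProd ρ τ)) :
    (reynolds ρ).rTensor _ (coindProdEval ρ U a) = coindProdEval ρ U a := by
  have h (k : N) : (act ρ k).toLinearMap.rTensor _ (coindProdEval ρ U a) =
      coindProdEval ρ U a := by
    conv_rhs => rw [← (mem_invariants _ a).1 ha k, coindProdEval_act]
    rfl
  rw [reynolds, LinearMap.rTensor_smul]
  have hsum : (∑ k : N, (act ρ k).toLinearMap).rTensor (SymmetricAlgebra F U) =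
      ∑ k : N, (act ρ k).toLinearMap.rTensor (SymmetricAlgebra F U) :=
    map_sum (LinearMap.rTensorHom (R := F) (SymmetricAlgebra F U)) _ _
  rw [hsum, LinearMap.smul_apply, LinearMap.sum_apply]
  simp only [h]
  simp [← Nat.cast_smul_eq_nsmul F, smul_smul, hN]

/-- The image is fixed by R on the left factor, hence congruent to 1 ⊗ (projection of a to S(U));
that projection is a positive invariant of G/N, so it lies in the Hilbert ideal on the right. -/
theorem coindProdEval_mem_hilbertTensorIdeal [N.Normal] [Fintype N] (hN : (Fintype.card N : F) ≠ 0)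
    (ρ : Representation F N W) (τ : Representation F (G ⧸ N) U)
    {a : SymmetricAlgebra F (Representation.coindV N.subtype ρ × U)}
    (ha : a ∈ posInvariants (coindProd ρ τ)) :
    coindProdEval ρ U a ∈ hilbertTensorIdeal ρ τ := by
  have h0 := rTensor_reynolds_sub_mem hN ρ τ (coindProdEval ρ U a)
  rw [rTensor_reynolds_coindProdEval hN ρ τ ha.1, augLeft_coindProdEval] at h0
  have h : symMap (LinearMap.snd F _ U) a ∈ posInvariants (τ.comp (QuotientGroup.mk' N)) :=
    symMap_mem_posInvariants (fun _ _ => rfl) ha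
  have h1 : symMap (LinearMap.snd F _ U) a ∈ posInvariants τ := by
    refine ⟨(mem_invariants _ _).2 fun q => ?_, h.2⟩
    obtain ⟨g, rfl⟩ := QuotientGroup.mk'_surjective N q
    exact (mem_invariants _ _).1 h.1 g
  exact (Submodule.sub_mem_iff_left _ (tmul_mem_tensorIdeal_right 1 (Ideal.subset_span h1))).1 h0

theorem coindProdEval_symMap (ρ : Representation F N W) (s : SymmetricAlgebra F W)
    (t : SymmetricAlgebra F U) :
    coindProdEval ρ U (symMap (LinearMap.inl F _ U) (symMap (coindIncl ρ) s) *
      symMap (LinearMap.inr F _ U) t) = s ⊗ₜ t := by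
  have h1 : (coindProdEval ρ U).comp (symMap (LinearMap.inl F _ U ∘ₗ coindIncl ρ)) =
      Algebra.TensorProduct.includeLeft := by
    refine SymmetricAlgebra.algHom_ext (LinearMap.ext fun w => ?_)
    have := congr($(coindEval_one_comp_coindIncl ρ) w)
    rw [LinearMap.comp_apply, coindEval_apply] at this
    simp [this]
  have h2 : (coindProdEval ρ U).comp (symMap (LinearMap.inr F _ U)) =
      Algebra.TensorProduct.includeRight := by
    refine SymmetricAlgebra.algHom_ext (LinearMap.ext fun u => ?_)
    simp
  have h1' := congr($h1 s)
  have h2' := congr($h2 t)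
  rw [AlgHom.comp_apply] at h1' h2'
  rw [map_mul, symMap_comp, h1', h2']
  simp

end Normal

/-- The factors s, t are taken outside the Hilbert ideals in the exact degrees `d` and `e`; over a
field s ⊗ t then survives in the tensor product of the quotients. -/
theorem add_succ_le_beta {F : Type u} {G : Type v} [Field F] [Group G] [Fintype G]
    (hG : (Fintype.card G : F) ≠ 0) {N : Subgroup G} [N.Normal] [Fintype N]
    (hN : (Fintype.card N : F) ≠ 0) [Fintype (G ⧸ N)] (hQ : (Fintype.card (G ⧸ N) : F) ≠ 0)
    {d e : ℕ} (hd : (d : ℕ∞) < beta F N) (he : (e : ℕ∞) < beta F (G ⧸ N)) :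
    ((d + e + 1 : ℕ) : ℕ∞) ≤ beta F G := by
  obtain ⟨W, _, _, _, ρ, hρ⟩ := exists_lt_betaRep hd
  obtain ⟨U, _, _, _, τ, hτ⟩ := exists_lt_betaRep he
  rw [lt_betaRep_iff] at hρ hτ
  have hρ := mt (generatedInDegreeLE_of_le_hilbertIdeal hN) hρ
  have hτ := mt (generatedInDegreeLE_of_le_hilbertIdeal hQ) hτ
  push Not at hρ hτ
  obtain ⟨s, hs, hsJ⟩ := hρ
  obtain ⟨t, ht, htJ⟩ := hτ
  -- With the trivial subgroup, every element is K-invariant and the excluded space is the Hilbert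
  -- ideal of the G-module.
  refine succ_le_beta hG (ρ := coindProd ρ τ) (K := ⊥)
    (mul_mem_homogeneousPart
      (symMap_mem_homogeneousPart (LinearMap.inl F _ U)
        (symMap_mem_homogeneousPart (coindIncl ρ) hs))
      (symMap_mem_homogeneousPart (LinearMap.inr F _ U) ht))
    ((mem_invariants _ _).2 fun k => ?_) fun h => ?_
  · rw [Subsingleton.elim k 1, act_one]
  · have key : posInvariants (coindProd ρ τ) *
        Subalgebra.toSubmodule (invariants (restrict (coindProd ρ τ) ⊥)) ≤
        ((hilbertTensorIdeal ρ τ).restrictScalars F).comap (coindProdEval ρ U).toLinearMap := by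
      refine Submodule.mul_le.2 fun a ha b _ => ?_
      change coindProdEval ρ U (a * b) ∈ hilbertTensorIdeal ρ τ
      rw [map_mul]
      exact Ideal.mul_mem_right _ _ (coindProdEval_mem_hilbertTensorIdeal hN ρ τ ha)
    have h0 : coindProdEval ρ U _ ∈ hilbertTensorIdeal ρ τ := key h
    rw [coindProdEval_symMap] at h0
    exact tmul_notMem_tensorIdeal hsJ htJ h0

end NoetherNumber

theorem theorem1p2 {F : Type*} {G : Type*} [Field F] [Group G] [Finite G]
    (hchar : ¬ ringChar F ∣ Nat.card G) :
    (∀ H : Subgroup G, H ≠ ⊤ → NoetherNumber.beta F H < NoetherNumber.beta F G) ∧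
    (∀ (N : Subgroup G) [N.Normal],
      NoetherNumber.beta F N + NoetherNumber.beta F (G ⧸ N) ≤ NoetherNumber.beta F G + 1) := by
  classical
  have := Fintype.ofFinite G
  have hcard : (Nat.card G : F) ≠ 0 := fun h => hchar ((ringChar.spec F _).1 h)
  have hG : (Fintype.card G : F) ≠ 0 := by rwa [← Nat.card_eq_fintype_card]
  have hdvd {n : ℕ} (hn : n ∣ Nat.card G) : (n : F) ≠ 0 := fun h =>
    hchar (((ringChar.spec F n).1 h).trans hn)
  have hsub (K : Subgroup G) : (Fintype.card K : F) ≠ 0 := by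
    rw [← Nat.card_eq_fintype_card]
    exact hdvd K.card_subgroup_dvd_card
  refine ⟨fun H hH => ?_, fun N _ => ?_⟩
  · obtain ⟨n, hn⟩ := ENat.ne_top_iff_exists.1
      (ne_top_of_le_ne_top (ENat.natCast_ne_top _) (NoetherNumber.beta_le_card (hsub H)))
    rw [← hn]
    obtain _ | d := n
    -- The value 0 has no predecessor to feed into `add_two_le_beta`; positivity of β(G) settles it.
    · exact lt_of_lt_of_le (by simp) (NoetherNumber.one_le_beta F G hG)
    · refine lt_of_lt_of_le ?_ (NoetherNumber.add_two_le_beta hG (hsub H) hH (d := d) ?_)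
      · exact_mod_cast Nat.lt_succ_self (d + 1)
      · rw [← hn]
        exact_mod_cast Nat.lt_succ_self d
  · have hQ : (Fintype.card (G ⧸ N) : F) ≠ 0 := by
      rw [← Nat.card_eq_fintype_card]
      exact hdvd N.card_quotient_dvd_card
    obtain ⟨n, hn⟩ := ENat.ne_top_iff_exists.1
      (ne_top_of_le_ne_top (ENat.natCast_ne_top _) (NoetherNumber.beta_le_card (hsub N)))
    obtain ⟨m, hm⟩ := ENat.ne_top_iff_exists.1
      (ne_top_of_le_ne_top (ENat.natCast_ne_top _) (NoetherNumber.beta_le_card hQ))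
    have hn1 := NoetherNumber.one_le_beta F N (hsub N)
    have hm1 := NoetherNumber.one_le_beta F (G ⧸ N) hQ
    rw [← hn] at hn1
    rw [← hm] at hm1
    obtain ⟨d, rfl⟩ : ∃ d, n = d + 1 := ⟨n - 1, by have : 1 ≤ n := by exact_mod_cast hn1
                                                   omega⟩
    obtain ⟨e, rfl⟩ : ∃ e, m = e + 1 := ⟨m - 1, by have : 1 ≤ m := by exact_mod_cast hm1
                                                   omega⟩
    have h := NoetherNumber.add_succ_le_beta hG (hsub N) hQ (d := d) (e := e)
      (by rw [← hn]; exact_mod_cast Nat.lt_succ_self d)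
      (by rw [← hm]; exact_mod_cast Nat.lt_succ_self e)
    rw [← hn, ← hm]
    -- With β(N) = d + 1 and β(G/N) = e + 1, the sum is (d + e + 1) + 1.
    refine le_trans (le_of_eq ?_) (add_le_add_left h 1)
    push_cast
    ring
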